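/- Let $M$ be a smooth manifold (finite-dimensional, Hausdorff, second countable, without boundary), let $G$ be any finite-dimensional real Lie group, and let $\pi : P \to M$ be a smooth principal $G$-bundle. The support $\mathrm{Supp}(v)$ of a vector field $v$ is the closure of the set of points where $v$ is nonzero. Let $\Gamma_c(TM)$ be the Lie algebra of smooth compactly supported vector fields on $M$, and let $\Gamma_c(TP)^G$ be the Lie algebra of smooth $G$-invariant vector fields on $P$ that vanish outside $\pi^{-1}(K)$ for some compact $K \subseteq M$ (the compact set may depend on the field). Let $\pi_* : \Gamma_c(TP)^G \to \Gamma_c(TM)$ be the pushforward of $G$-invariant vector fields, and let $\Gamma_c(TP)^G_v$ be its kernel, the ideal of vertical vector fields. Let $\sigma : \Gamma_c(TM) \to \Gamma_c(TP)^G$ be a homomorphism of real Lie algebras that splits the exact sequence of Lie algebras $$0 \to \Gamma_c(TP)^G_v \to \Gamma_c(TP)^G \xrightarrow{\ \pi_*\ } \Gamma_c(TM) \to 0,$$ that is, $\pi_* \circ \sigma = \mathrm{id}$ (no continuity, locality or $C^\infty(M)$-linearity of $\sigma$ is assumed). Then $\sigma$ is local: for every $v \in \Gamma_c(TM)$, $$\pi\bigl(\mathrm{Supp}(\sigma(v))\bigr)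 \subseteq \mathrm{Supp}(v).$$ -/

import Mathlib

open Set Topology Bundle VectorField
open scoped Manifold ContDiff

noncomputable section

section VectorFields

set_option linter.unusedSectionVars false

variable {E : Type*} [NormedAddCommGroup E] [NormedSpace ℝ E] [FiniteDimensional ℝ E]
  {H : Type*} [TopologicalSpace H] (I : ModelWithCorners ℝ E H)
  (M : Type*) [TopologicalSpace M] [ChartedSpace H M] [IsManifold I ∞ M]

/-- The space of smooth vector fields on `M`, i.e. smooth sections of the tangent bundle. -/
abbrev SmoothVectorField : Type _ :=
  ContMDiffSection I E ∞ (fun x : M => TangentSpace I x)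

variable {I M}

theorem SmoothVectorField.mdifferentiableAt (v : SmoothVectorField I M) (x : M) :
    MDifferentiableAt I I.tangent (fun y => (⟨y, v y⟩ : TangentBundle I M)) x :=
  (v.contMDiff x).mdifferentiableAt (by simp)

theorem SmoothVectorField.contMDiff_mlieBracket (v w : SmoothVectorField I M) :
    ContMDiff I I.tangent ∞
      (fun x => (⟨x, mlieBracket I v w x⟩ : TangentBundle I M)) := by
  have : CompleteSpace E := FiniteDimensional.complete ℝ E
  have : IsManifold I (((⊤ : ℕ∞) : WithTop ℕ∞) + 1) M := ‹IsManifold I ∞ M›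
  have : IsManifold I (minSmoothness ℝ 3) M := by
    rw [minSmoothness_of_isRCLikeNormedField]; infer_instance
  intro x
  exact ContMDiffAt.mlieBracket_vectorField (m := ⊤) (n := ⊤) (v.contMDiff x) (w.contMDiff x)
    (by simp)

/-- The Lie bracket `[v, w]` of smooth vector fields. -/
instance SmoothVectorField.instBracket :
    Bracket (SmoothVectorField I M) (SmoothVectorField I M) where
  bracket v w := ⟨fun x => mlieBracket I v w x, v.contMDiff_mlieBracket w⟩

theorem SmoothVectorField.lie_apply (v w : SmoothVectorField I M) (x : M) :
    (⁅v, w⁆ : SmoothVectorField I M) x = mlieBracket I v w x := rfl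

/-- Smooth vector fields form a Lie ring. -/
instance SmoothVectorField.instLieRing : LieRing (SmoothVectorField I M) where
  add_lie u v w := by
    have : CompleteSpace E := FiniteDimensional.complete ℝ E
    ext x
    exact mlieBracket_add_left (u.mdifferentiableAt x) (v.mdifferentiableAt x)
  lie_add u v w := by
    have : CompleteSpace E := FiniteDimensional.complete ℝ E
    ext x
    exact mlieBracket_add_right (v.mdifferentiableAt x) (w.mdifferentiableAt x)
  lie_self v := by
    ext x
    rw [SmoothVectorField.lie_apply, mlieBracket_self]
    rfl
  leibniz_lie u v w := by
    have : CompleteSpace E := FiniteDimensional.complete ℝ E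
    have : IsManifold I (minSmoothness ℝ 3) M := by
      rw [minSmoothness_of_isRCLikeNormedField]; infer_instance
    have h2 : minSmoothness ℝ 2 ≤ (∞ : WithTop ℕ∞) := by
      rw [minSmoothness_of_isRCLikeNormedField]; exact ENat.LEInfty.out
    ext x
    exact leibniz_identity_mlieBracket_apply ((u.contMDiff x).of_le h2)
      ((v.contMDiff x).of_le h2) ((w.contMDiff x).of_le h2)

/-- Smooth vector fields form a real Lie algebra. -/
instance SmoothVectorField.instLieAlgebra : LieAlgebra ℝ (SmoothVectorField I M) where
  lie_smul c v w := by
    have : CompleteSpace E := FiniteDimensional.complete ℝ E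
    ext x
    exact mlieBracket_const_smul_right (w.mdifferentiableAt x)

/-- The support of a vector field: the closure of the set of points where it does not vanish. -/
def SmoothVectorField.supp (v : SmoothVectorField I M) : Set M :=
  closure {x | v x ≠ 0}

theorem SmoothVectorField.isClosed_supp (v : SmoothVectorField I M) : IsClosed v.supp :=
  isClosed_closure

theorem SmoothVectorField.eq_zero_of_notMem_supp {v : SmoothVectorField I M} {x : M}
    (hx : x ∉ v.supp) : v x = 0 := by
  by_contra h
  exact hx (subset_closure h)

/-- The bracket vanishes where one of the fields vanishes on a neighbourhood. -/
theorem SmoothVectorField.lie_eq_zero_of_eventually (v w : SmoothVectorField I M) {x : M}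
    (hx : ∀ᶠ y in 𝓝 x, v y = 0) : (⁅v, w⁆ : SmoothVectorField I M) x = 0 := by
  have h : (fun y => v y) =ᶠ[𝓝 x] (fun y => (0 : Π y : M, TangentSpace I y) y) := hx
  have h2 := Filter.EventuallyEq.mlieBracket_vectorField_eq (I := I) (W := w) (W₁ := w)
    (V := (0 : Π y : M, TangentSpace I y)) (V₁ := v) h Filter.EventuallyEq.rfl
  rw [SmoothVectorField.lie_apply, h2, mlieBracket_zero_left]
  rfl

variable (I M)

/-- The Lie algebra `Γ_c(TM)` of smooth compactly supported vector fields on `M`. -/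
def compactVectorFields : LieSubalgebra ℝ (SmoothVectorField I M) where
  carrier := {v | IsCompact v.supp}
  zero_mem' := by
    have : (0 : SmoothVectorField I M).supp = ∅ := by
      simp [SmoothVectorField.supp]
    simp [this]
  add_mem' {v w} hv hw := by
    refine (hv.union hw).of_isClosed_subset (v + w).isClosed_supp ?_
    refine closure_minimal ?_ (v.isClosed_supp.union w.isClosed_supp)
    intro x hx
    by_contra h
    rw [mem_union, not_or] at h
    apply hx
    rw [ContMDiffSection.coe_add, Pi.add_apply, v.eq_zero_of_notMem_supp h.1,
      w.eq_zero_of_notMem_supp h.2, add_zero]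
  smul_mem' c v hv := by
    refine IsCompact.of_isClosed_subset hv (c • v).isClosed_supp ?_
    refine closure_minimal ?_ v.isClosed_supp
    intro x hx
    by_contra h
    apply hx
    rw [ContMDiffSection.coe_smul, Pi.smul_apply, v.eq_zero_of_notMem_supp h, smul_zero]
  lie_mem' {v w} hv _ := by
    refine IsCompact.of_isClosed_subset hv (⁅v, w⁆ : SmoothVectorField I M).isClosed_supp ?_
    refine closure_minimal ?_ v.isClosed_supp
    intro x hx
    by_contra h
    apply hx
    apply SmoothVectorField.lie_eq_zero_of_eventually
    filter_upwards [v.isClosed_supp.isOpen_compl.mem_nhds h] with y hy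
    exact v.eq_zero_of_notMem_supp hy

end VectorFields

section PrincipalBundles

set_option linter.unusedSectionVars false

variable {EM : Type*} [NormedAddCommGroup EM] [NormedSpace ℝ EM] [FiniteDimensional ℝ EM]
  {HM : Type*} [TopologicalSpace HM] (IM : ModelWithCorners ℝ EM HM)
  {EG : Type*} [NormedAddCommGroup EG] [NormedSpace ℝ EG] [FiniteDimensional ℝ EG]
  {HG : Type*} [TopologicalSpace HG] (IG : ModelWithCorners ℝ EG HG)
  {EP : Type*} [NormedAddCommGroup EP] [NormedSpace ℝ EP] [FiniteDimensional ℝ EP]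
  {HP : Type*} [TopologicalSpace HP] (IP : ModelWithCorners ℝ EP HP)
  {M : Type*} [TopologicalSpace M] [ChartedSpace HM M] [IsManifold IM ∞ M]
  (G : Type*) [TopologicalSpace G] [ChartedSpace HG G] [Group G] [LieGroup IG ∞ G]
  {P : Type*} [TopologicalSpace P] [ChartedSpace HP P] [IsManifold IP ∞ P]
  [MulAction Gᵐᵒᵖ P]

/-- `proj : P → M` is a smooth principal `G`-bundle. The right action of `G` on `P` is written as an
action of the opposite group: `p · g` is `MulOpposite.op g • p`. -/
structure IsPrincipalBundle (proj : P → M) : Prop where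
  contMDiff_proj : ContMDiff IP IM ∞ proj
  contMDiff_act : ContMDiff (IP.prod IG) IP ∞ (fun q : P × G => MulOpposite.op q.2 • q.1)
  proj_act : ∀ (p : P) (g : G), proj (MulOpposite.op g • p) = proj p
  /-- Every point of `M` has an open neighbourhood `U` with a `G`-equivariant diffeomorphism
  `proj⁻¹(U) ≅ U × G` over `U`. -/
  exists_trivialization : ∀ m : M, ∃ e : Trivialization G proj, m ∈ e.baseSet ∧
    ContMDiffOn IP (IM.prod IG) ∞ e e.source ∧
    ContMDiffOn (IM.prod IG) IP ∞ e.toOpenPartialHomeomorph.symm e.target ∧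
    ∀ p ∈ e.source, ∀ g : G, (e (MulOpposite.op g • p)).2 = (e p).2 * g

variable {IM IG IP G}

theorem IsPrincipalBundle.contMDiff_right {proj : P → M} (hP : IsPrincipalBundle IM IG IP G proj)
    (g : G) : ContMDiff IP IP ∞ (fun p : P => MulOpposite.op g • p) :=
  hP.contMDiff_act.comp (contMDiff_id.prodMk contMDiff_const)

theorem IsPrincipalBundle.isInvertible_mfderiv_right {proj : P → M}
    (hP : IsPrincipalBundle IM IG IP G proj) (g : G) (p : P) :
    (mfderiv IP IP (fun q : P => MulOpposite.op g • q) p).IsInvertible := by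
  let Φ : P ≃ₘ⟮IP, IP⟯ P :=
    { toEquiv := MulAction.toPerm (MulOpposite.op g)
      contMDiff_toFun := hP.contMDiff_right g
      contMDiff_invFun := by
        have := hP.contMDiff_right g⁻¹
        rwa [MulOpposite.op_inv] at this }
  exact ⟨Φ.mfderivToContinuousLinearEquiv (by simp) p, rfl⟩

/-- A vector field `v` on `P` is `G`-invariant if `d(R_g)_p (v p) = v (p · g)` for all `p`, `g`. -/
def IsInvariantVectorField (G : Type*) [Group G] [MulAction Gᵐᵒᵖ P]
    (v : SmoothVectorField IP P) : Prop :=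
  ∀ (g : G) (p : P),
    mfderiv IP IP (fun q : P => MulOpposite.op g • q) p (v p) = v (MulOpposite.op g • p)

theorem IsPrincipalBundle.isInvariantVectorField_lie {proj : P → M}
    (hP : IsPrincipalBundle IM IG IP G proj) {v w : SmoothVectorField IP P}
    (hv : IsInvariantVectorField G v) (hw : IsInvariantVectorField G w) :
    IsInvariantVectorField G (⁅v, w⁆ : SmoothVectorField IP P) := by
  have : CompleteSpace EP := FiniteDimensional.complete ℝ EP
  have : IsManifold IP (minSmoothness ℝ 3) P := by
    rw [minSmoothness_of_isRCLikeNormedField]; infer_instance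
  intro g p
  have key : ∀ u : SmoothVectorField IP P, IsInvariantVectorField G u →
      mpullback IP IP (fun q : P => MulOpposite.op g • q) u = u := by
    intro u hu
    funext q
    rw [mpullback_apply, ← hu g q]
    exact (hP.isInvertible_mfderiv_right g q).inverse_apply_eq.2 rfl
  have h := mpullback_mlieBracket (I := IP) (I' := IP) (n := ∞)
    (f := fun q : P => MulOpposite.op g • q) (x₀ := p)
    (v.mdifferentiableAt _) (w.mdifferentiableAt _) (hP.contMDiff_right g p)
    (by rw [minSmoothness_of_isRCLikeNormedField]; exact ENat.LEInfty.out)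
  rw [key v hv, key w hw, mpullback_apply] at h
  exact ((hP.isInvertible_mfderiv_right g p).inverse_apply_eq.1 h).symm

/-- The Lie algebra `Γ_c(TP)^G` of smooth `G`-invariant vector fields on `P` that vanish outside
`proj⁻¹(K)` for some compact subset `K` of `M`. -/
def invariantVectorFields {proj : P → M} (hP : IsPrincipalBundle IM IG IP G proj) :
    LieSubalgebra ℝ (SmoothVectorField IP P) where
  carrier := {v | IsInvariantVectorField G v ∧
    ∃ K : Set M, IsCompact K ∧ proj '' v.supp ⊆ K}
  zero_mem' := by
    refine ⟨fun g p => ?_, ∅, isCompact_empty, ?_⟩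
    · exact map_zero _
    · simp [SmoothVectorField.supp]
  add_mem' {v w} := by
    rintro ⟨hv, K, hK, hvK⟩ ⟨hw, L, hL, hwL⟩
    refine ⟨fun g p => ?_, K ∪ L, hK.union hL, ?_⟩
    · rw [ContMDiffSection.coe_add, Pi.add_apply, Pi.add_apply, map_add, hv g p, hw g p]
    · have : (v + w).supp ⊆ v.supp ∪ w.supp := by
        refine closure_minimal ?_ (v.isClosed_supp.union w.isClosed_supp)
        intro x hx
        by_contra h
        rw [mem_union, not_or] at h
        apply hx
        rw [ContMDiffSection.coe_add, Pi.add_apply, v.eq_zero_of_notMem_supp h.1,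
          w.eq_zero_of_notMem_supp h.2, add_zero]
      refine (image_mono this).trans ?_
      rw [image_union]
      exact union_subset_union hvK hwL
  smul_mem' c v := by
    rintro ⟨hv, K, hK, hvK⟩
    refine ⟨fun g p => ?_, K, hK, (image_mono ?_).trans hvK⟩
    · rw [ContMDiffSection.coe_smul, Pi.smul_apply, Pi.smul_apply, map_smul, hv g p]
    · refine closure_minimal ?_ v.isClosed_supp
      intro x hx
      by_contra h
      apply hx
      rw [ContMDiffSection.coe_smul, Pi.smul_apply, v.eq_zero_of_notMem_supp h, smul_zero]
  lie_mem' {v w} := by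
    rintro ⟨hv, K, hK, hvK⟩ ⟨hw, -⟩
    refine ⟨hP.isInvariantVectorField_lie hv hw, K, hK, (image_mono ?_).trans hvK⟩
    refine closure_minimal ?_ v.isClosed_supp
    intro x hx
    by_contra h
    apply hx
    apply SmoothVectorField.lie_eq_zero_of_eventually
    filter_upwards [v.isClosed_supp.isOpen_compl.mem_nhds h] with y hy
    exact v.eq_zero_of_notMem_supp hy

/-- `σ : Γ_c(TM) → Γ_c(TP)^G` splits the pushforward `proj_*`, i.e. `proj_* ∘ σ = id`: the invariant
field `σ(v)` projects to `v`. -/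
def IsSplitting {proj : P → M} (hP : IsPrincipalBundle IM IG IP G proj)
    (σ : compactVectorFields IM M → invariantVectorFields hP) : Prop :=
  ∀ (v : compactVectorFields IM M) (p : P),
    mfderiv IP IM proj p ((σ v : SmoothVectorField IP P) p) = (v : SmoothVectorField IM M) (proj p)

end PrincipalBundles

end

noncomputable section

section BaseManifold

set_option linter.unusedSectionVars false

variable {E : Type*} [NormedAddCommGroup E] [NormedSpace ℝ E] [FiniteDimensional ℝ E]
  {H : Type*} [TopologicalSpace H] {I : ModelWithCorners ℝ E H}
  {M : Type*} [TopologicalSpace M] [ChartedSpace H M] [IsManifold I ∞ M]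

namespace SmoothVectorField

theorem supp_subset_of_forall {v w : SmoothVectorField I M} (h : ∀ x, w x = 0 → v x = 0) :
    v.supp ⊆ w.supp :=
  closure_mono fun x hx hw => hx (h x hw)

theorem supp_lie_subset_left (v w : SmoothVectorField I M) :
    (⁅v, w⁆ : SmoothVectorField I M).supp ⊆ v.supp := by
  refine closure_minimal (fun x hx => ?_) v.isClosed_supp
  by_contra h
  refine hx (lie_eq_zero_of_eventually v w ?_)
  filter_upwards [v.isClosed_supp.isOpen_compl.mem_nhds h] with y hy
  exact v.eq_zero_of_notMem_supp hy

theorem supp_lie_subset_right (v w : SmoothVectorField I M) :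
    (⁅v, w⁆ : SmoothVectorField I M).supp ⊆ w.supp := by
  refine Subset.trans (supp_subset_of_forall fun x hx => ?_) (supp_lie_subset_left w v)
  rw [← lie_skew, ContMDiffSection.coe_neg, Pi.neg_apply, hx, neg_zero]

theorem lie_apply_congr {v v' w w' : SmoothVectorField I M} {x : M}
    (hv : ∀ᶠ y in 𝓝 x, v y = v' y) (hw : ∀ᶠ y in 𝓝 x, w y = w' y) :
    (⁅v, w⁆ : SmoothVectorField I M) x = (⁅v', w'⁆ : SmoothVectorField I M) x :=
  Filter.EventuallyEq.mlieBracket_vectorField_eq (I := I) hv hw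

end SmoothVectorField

namespace compactVectorFields

/-- The product `f • v` of a compactly supported vector field with a smooth function. -/
def funSMul (f : C^∞⟮I, M; 𝓘(ℝ), ℝ⟯) (v : compactVectorFields I M) : compactVectorFields I M :=
  ⟨⟨fun x => f x • (v : SmoothVectorField I M) x,
    ContMDiff.smul_section f.contMDiff (v : SmoothVectorField I M).contMDiff⟩,
    IsCompact.of_isClosed_subset v.2 (SmoothVectorField.isClosed_supp _)
      (SmoothVectorField.supp_subset_of_forall fun x hx =>
        show f x • (v : SmoothVectorField I M) x = 0 by rw [hx, smul_zero])⟩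

theorem funSMul_apply (f : C^∞⟮I, M; 𝓘(ℝ), ℝ⟯) (v : compactVectorFields I M) (x : M) :
    (funSMul f v : SmoothVectorField I M) x = f x • (v : SmoothVectorField I M) x := rfl

theorem supp_funSMul_subset (f : C^∞⟮I, M; 𝓘(ℝ), ℝ⟯) (v : compactVectorFields I M) :
    (funSMul f v : SmoothVectorField I M).supp ⊆ (v : SmoothVectorField I M).supp :=
  SmoothVectorField.supp_subset_of_forall fun x hx => by rw [funSMul_apply, hx, smul_zero]

theorem lie_funSMul_apply (f : C^∞⟮I, M; 𝓘(ℝ), ℝ⟯) (v w : compactVectorFields I M) (x : M) :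
    ((⁅v, funSMul f w⁆ : compactVectorFields I M) : SmoothVectorField I M) x =
      mvfderiv I f x ((v : SmoothVectorField I M) x) • (w : SmoothVectorField I M) x +
        f x • ((⁅v, w⁆ : compactVectorFields I M) : SmoothVectorField I M) x := by
  have : CompleteSpace E := FiniteDimensional.complete ℝ E
  exact mlieBracket_smul_right (f.contMDiff.mdifferentiableAt (by simp))
    ((w : SmoothVectorField I M).mdifferentiableAt x)

theorem funSMul_lie_apply (f : C^∞⟮I, M; 𝓘(ℝ), ℝ⟯) (v w : compactVectorFields I M) (x : M) :
    ((⁅funSMul f v, w⁆ : compactVectorFields I M) : SmoothVectorField I M) x =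
      - mvfderiv I f x ((w : SmoothVectorField I M) x) • (v : SmoothVectorField I M) x +
        f x • ((⁅v, w⁆ : compactVectorFields I M) : SmoothVectorField I M) x := by
  have : CompleteSpace E := FiniteDimensional.complete ℝ E
  exact mlieBracket_smul_left (f.contMDiff.mdifferentiableAt (by simp))
    ((v : SmoothVectorField I M).mdifferentiableAt x)

end compactVectorFields

/-- The composition of a polynomial with a smooth function. -/
def Polynomial.compSmooth (ℓ : C^∞⟮I, M; 𝓘(ℝ), ℝ⟯) (q : Polynomial ℝ) : C^∞⟮I, M; 𝓘(ℝ), ℝ⟯ :=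
  ⟨fun x => q.eval (ℓ x),
    (by simpa using q.contDiff_aeval (𝕜 := ℝ) ∞ :
      ContDiff ℝ ∞ fun t : ℝ => q.eval t).contMDiff.comp ℓ.contMDiff⟩

theorem Polynomial.compSmooth_apply (ℓ : C^∞⟮I, M; 𝓘(ℝ), ℝ⟯) (q : Polynomial ℝ) (x : M) :
    q.compSmooth ℓ x = q.eval (ℓ x) := rfl

theorem Polynomial.mvfderiv_compSmooth (ℓ : C^∞⟮I, M; 𝓘(ℝ), ℝ⟯) (q : Polynomial ℝ) (x : M)
    (u : TangentSpace I x) :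
    mvfderiv I (q.compSmooth ℓ) x u = q.derivative.eval (ℓ x) * mvfderiv I ℓ x u := by
  have h1 : MDifferentiableAt 𝓘(ℝ) 𝓘(ℝ) (fun t : ℝ => q.eval t) (ℓ x) :=
    q.differentiableAt.mdifferentiableAt
  have h2 : MDifferentiableAt I 𝓘(ℝ) ℓ x := ℓ.contMDiff.mdifferentiableAt (by simp)
  have h3 := mvfderiv_comp_apply (g := fun t : ℝ => q.eval t) x h1 h2 u
  have h4 : mfderiv 𝓘(ℝ) 𝓘(ℝ) (fun t : ℝ => q.eval t) (ℓ x) =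
    fderiv ℝ (fun t : ℝ => q.eval t) (ℓ x) := mfderiv_eq_fderiv
  have h5 : ∀ c : ℝ, fderiv ℝ (fun t : ℝ => q.eval t) (ℓ x) c = q.derivative.eval (ℓ x) * c := by
    intro c
    rw [fderiv_eq_smul_deriv, Polynomial.deriv, smul_eq_mul, mul_comm]
  exact (h3.trans (DFunLike.congr_fun h4 _)).trans (h5 _)

/-- Near each point of a manifold of positive dimension there are a compactly supported vector
field `X` and a smooth function `ℓ` with `X ℓ = 1`. -/
theorem exists_vectorField_mvfderiv_eq_one [Nontrivial E] [T2Space M] {O : Set M} (hO : IsOpen O)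
    {y : M} (hy : y ∈ O) :
    ∃ (X : compactVectorFields I M) (ℓ : C^∞⟮I, M; 𝓘(ℝ), ℝ⟯) (V : Set M), IsOpen V ∧ y ∈ V ∧
      (X : SmoothVectorField I M).supp ⊆ O ∧
      ∀ x ∈ V, mvfderiv I ℓ x ((X : SmoothVectorField I M) x) = 1 := by
  obtain ⟨e, he⟩ := exists_ne (0 : E)
  obtain ⟨lam, hlam⟩ : ∃ lam : E →L[ℝ] ℝ, lam e = 1 := SeparatingDual.exists_eq_one he
  obtain ⟨χ, -, hχ⟩ := (SmoothBumpFunction.nhds_basis_tsupport (I := I) y).mem_iff.1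
    (hO.mem_nhds hy)
  let t := trivializationAt E (TangentSpace I : M → Type _) y
  have htb : t.baseSet = (chartAt H y).source := TangentBundle.trivializationAt_baseSet y
  have htX : ContMDiffOn I I.tangent ∞
      (fun x => (⟨x, t.symm x e⟩ : TangentBundle I M)) t.baseSet := by
    intro x hx
    rw [t.contMDiffWithinAt_section _ hx]
    have : ContMDiffOn I 𝓘(ℝ, E) ∞ (fun _ : M => e) t.baseSet := contMDiffOn_const
    exact this.congr (fun x hx => by simp [hx]) x hx
  have hX : ContMDiff I I.tangent ∞
      (fun x => (⟨x, χ x • t.symm x e⟩ : TangentBundle I M)) :=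
    ContMDiffOn.smul_section_of_tsupport (s := fun x => t.symm x e) (ψ := χ) (u := t.baseSet)
      χ.contMDiff.contMDiffOn t.open_baseSet (htb ▸ χ.tsupport_subset_chartAt_source) htX
  let X : SmoothVectorField I M := ⟨fun x => χ x • t.symm x e, hX⟩
  have hXχ : X.supp ⊆ tsupport χ := closure_mono fun x hx h0 => hx <| by
    change χ x • t.symm x e = 0
    rw [h0, zero_smul]
  have hℓ : ContMDiff I 𝓘(ℝ) ∞ (fun x => χ x • lam (extChartAt I y x)) := by
    refine χ.contMDiff_smul ?_
    exact lam.contDiff.contMDiff.comp_contMDiffOn (contMDiffOn_extChartAt)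
  obtain ⟨V, hVs, hVo, hyV⟩ := mem_nhds_iff.1 (Filter.inter_mem χ.eventuallyEq_one
    (chart_source_mem_nhds H y))
  refine ⟨⟨X, χ.hasCompactSupport.of_isClosed_subset X.isClosed_supp hXχ⟩, ⟨_, hℓ⟩, V, hVo, hyV,
    hXχ.trans hχ, fun x hx => ?_⟩
  have hχx : χ x = 1 := (hVs hx).1
  have hxs : x ∈ (chartAt H y).source := (hVs hx).2
  have hXx : X x = t.symm x e := by
    change χ x • t.symm x e = _
    rw [hχx, one_smul]
  have heq : (fun x => χ x • lam (extChartAt I y x)) =ᶠ[𝓝 x] lam ∘ extChartAt I y := by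
    filter_upwards [hVo.mem_nhds hx] with z hz
    rw [show χ z = 1 from (hVs hz).1, one_smul]; rfl
  have hd : MDifferentiableAt I 𝓘(ℝ, E) (extChartAt I y) x := mdifferentiableAt_extChartAt hxs
  have hlm : MDifferentiableAt 𝓘(ℝ, E) 𝓘(ℝ) lam (extChartAt I y x) :=
    lam.differentiableAt.mdifferentiableAt
  have h1 : mfderiv I 𝓘(ℝ, E) (extChartAt I y) x (X x) = e := by
    rw [hXx, ← TangentBundle.continuousLinearMapAt_trivializationAt hxs]
    rw [← t.symmL_apply (R := ℝ) (htb ▸ hxs)]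
    exact t.continuousLinearMapAt_symmL (R := ℝ) (htb ▸ hxs) e
  have h2 : mfderiv 𝓘(ℝ, E) 𝓘(ℝ) lam (extChartAt I y x) = lam := lam.mfderiv_eq
  have h3 := mfderiv_comp_apply x hlm hd (X x)
  rw [← heq.mfderiv_eq] at h3
  refine h3.trans ?_
  rw [h1]
  exact (DFunLike.congr_fun h2 e).trans hlam

/-- A finite-codimensional ideal of the Lie algebra of compactly supported vector fields with
support in `O` contains the fields supported where a field `X` of this algebra satisfies `X ℓ = 1`.
The ideal is given as the kernel of a linear map. -/
theorem map_eq_zero_of_supp_subset_of_mvfderiv_eq_one {W : Type*} [AddCommGroup W] [Module ℝ W]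
    [FiniteDimensional ℝ W] (T : compactVectorFields I M →ₗ[ℝ] W) {O : Set M}
    (hT : ∀ v w : compactVectorFields I M, (v : SmoothVectorField I M).supp ⊆ O →
      (w : SmoothVectorField I M).supp ⊆ O → T w = 0 → T ⁅v, w⁆ = 0)
    {X : compactVectorFields I M} {ℓ : C^∞⟮I, M; 𝓘(ℝ), ℝ⟯} {V : Set M} (hV : IsOpen V)
    (hXO : (X : SmoothVectorField I M).supp ⊆ O)
    (hX : ∀ x ∈ V, mvfderiv I ℓ x ((X : SmoothVectorField I M) x) = 1)
    {Y : compactVectorFields I M} (hY : (Y : SmoothVectorField I M).supp ⊆ V) : T Y = 0 := by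
  have hVO : V ⊆ O := fun x hx => hXO <| subset_closure fun h0 => by
    have := hX x hx
    rw [h0, map_zero] at this
    exact zero_ne_one this
  have key : ∀ n : ℕ, ∀ q : Polynomial ℝ, q.natDegree = n → q ≠ 0 →
      (∃ Z : compactVectorFields I M, T Z = 0 ∧ (Z : SmoothVectorField I M).supp ⊆ O ∧
        ∀ x ∈ V, (Z : SmoothVectorField I M) x =
          (Polynomial.compSmooth ℓ q) x • (X : SmoothVectorField I M) x) →
      ∃ Z : compactVectorFields I M, T Z = 0 ∧ (Z : SmoothVectorField I M).supp ⊆ O ∧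
        ∀ x ∈ V, (Z : SmoothVectorField I M) x = (X : SmoothVectorField I M) x := by
    intro n
    induction n with
    | zero =>
      rintro q hq hq0 ⟨Z, hTZ, hZO, hZ⟩
      obtain ⟨c, rfl⟩ := Polynomial.natDegree_eq_zero.1 hq
      have hc : c ≠ 0 := by rintro rfl; simp at hq0
      refine ⟨c⁻¹ • Z, by rw [map_smul, hTZ, smul_zero],
        (SmoothVectorField.supp_subset_of_forall fun x hx => ?_).trans hZO, fun x hx => ?_⟩
      · change c⁻¹ • (Z : SmoothVectorField I M) x = 0
        rw [hx, smul_zero]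
      · change c⁻¹ • (Z : SmoothVectorField I M) x = _
        rw [hZ x hx, Polynomial.compSmooth_apply, Polynomial.eval_C, smul_smul,
          inv_mul_cancel₀ hc, one_smul]
    | succ n ih =>
      rintro q hq hq0 ⟨Z, hTZ, hZO, hZ⟩
      have hq' : q.derivative.natDegree = n := by
        rw [Polynomial.natDegree_derivative, hq, Nat.add_sub_cancel]
      refine ih q.derivative hq' (fun h0 => ?_) ⟨⁅X, Z⁆, hT X Z hXO hZO hTZ,
        (SmoothVectorField.supp_lie_subset_left _ _).trans hXO, fun x hx => ?_⟩
      · have := Polynomial.derivative_eq_zero.1 h0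
        omega
      · have h1 : ((⁅X, Z⁆ : compactVectorFields I M) : SmoothVectorField I M) x =
            ((⁅X, compactVectorFields.funSMul (q.compSmooth ℓ) X⁆ : compactVectorFields I M) :
              SmoothVectorField I M) x := by
          refine SmoothVectorField.lie_apply_congr (Filter.Eventually.of_forall fun _ => rfl) ?_
          filter_upwards [hV.mem_nhds hx] with z hz
          rw [hZ z hz, compactVectorFields.funSMul_apply]
        rw [h1, compactVectorFields.lie_funSMul_apply, lie_self, Polynomial.mvfderiv_compSmooth,
          hX x hx, mul_one, Polynomial.compSmooth_apply]
        exact (congrArg _ (smul_zero _)).trans (add_zero _)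
  -- a nonzero polynomial in `ℓ` times `X` lies in the kernel
  obtain ⟨q, hq0, hq⟩ : ∃ q : Polynomial ℝ, q ≠ 0 ∧
      T (compactVectorFields.funSMul (q.compSmooth ℓ) X) = 0 := by
    let Φ : Polynomial ℝ →ₗ[ℝ] W :=
      { toFun := fun q => T (compactVectorFields.funSMul (q.compSmooth ℓ) X)
        map_add' := fun p q => by
          rw [← map_add]
          congr 1
          ext x
          simp [compactVectorFields.funSMul_apply, Polynomial.compSmooth_apply, add_smul]
        map_smul' := fun c q => by
          rw [RingHom.id_apply, ← map_smul]
          congr 1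
          ext x
          simp [compactVectorFields.funSMul_apply, Polynomial.compSmooth_apply, mul_smul] }
    by_contra! h
    have hinj : Function.Injective Φ := (injective_iff_map_eq_zero Φ).2 fun q hq => by
      by_contra hq0
      exact h q hq0 hq
    have := Module.Finite.of_injective Φ hinj
    exact Polynomial.not_finite this
  obtain ⟨Z₁, hTZ₁, hZ₁O, hZ₁⟩ := key _ q rfl hq0 ⟨_, hq,
    (compactVectorFields.supp_funSMul_subset _ _).trans hXO, fun x _ => rfl⟩
  let Z₂ : compactVectorFields I M := ⁅Z₁, compactVectorFields.funSMul
    ((Polynomial.C (1 / 2 : ℝ) * Polynomial.X ^ 2).compSmooth ℓ) X⁆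
  have hZ₂O : (Z₂ : SmoothVectorField I M).supp ⊆ O :=
    (SmoothVectorField.supp_lie_subset_left _ _).trans hZ₁O
  have hlie : ∀ v w : compactVectorFields I M, (v : SmoothVectorField I M).supp ⊆ O →
      (w : SmoothVectorField I M).supp ⊆ O → T v = 0 → T ⁅v, w⁆ = 0 := by
    intro v w hv hw h
    rw [← lie_skew, map_neg, hT w v hw hv h, neg_zero]
  have hTZ₂ : T Z₂ = 0 := hlie _ _ hZ₁O
    ((compactVectorFields.supp_funSMul_subset _ _).trans hXO) hTZ₁
  have hZ₂ : ∀ x ∈ V, (Z₂ : SmoothVectorField I M) x =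
      (compactVectorFields.funSMul ℓ X : SmoothVectorField I M) x := by
    intro x hx
    have h1 : (Z₂ : SmoothVectorField I M) x = ((⁅X, compactVectorFields.funSMul
        ((Polynomial.C (1 / 2 : ℝ) * Polynomial.X ^ 2).compSmooth ℓ) X⁆ : compactVectorFields I M) :
          SmoothVectorField I M) x := by
      refine SmoothVectorField.lie_apply_congr ?_ (Filter.Eventually.of_forall fun _ => rfl)
      filter_upwards [hV.mem_nhds hx] with z hz using hZ₁ z hz
    rw [h1, compactVectorFields.lie_funSMul_apply, lie_self, Polynomial.mvfderiv_compSmooth,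
      hX x hx, compactVectorFields.funSMul_apply]
    simp only [Polynomial.derivative_mul, Polynomial.derivative_C, Polynomial.derivative_X_pow,
      Polynomial.eval_add, Polynomial.eval_mul, Polynomial.eval_C, Polynomial.eval_pow,
      Polynomial.eval_X, Polynomial.eval_zero]
    refine (congrArg _ (smul_zero _)).trans ((add_zero _).trans ?_)
    congr 1
    push_cast
    ring
  let Q : compactVectorFields I M → compactVectorFields I M := fun Y =>
    ⁅Z₁, compactVectorFields.funSMul ℓ Y⁆ - ⁅Z₂, Y⁆
  have hTQ : ∀ Y : compactVectorFields I M, (Y : SmoothVectorField I M).supp ⊆ O →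
      T (Q Y) = 0 := by
    intro Y hYO
    rw [map_sub, hlie _ _ hZ₁O ((compactVectorFields.supp_funSMul_subset _ _).trans hYO) hTZ₁,
      hlie _ _ hZ₂O hYO hTZ₂, sub_zero]
  have hQ_in : ∀ Y : compactVectorFields I M, ∀ x ∈ V, (Q Y : SmoothVectorField I M) x =
      (Y : SmoothVectorField I M) x +
        mvfderiv I ℓ x ((Y : SmoothVectorField I M) x) • (X : SmoothVectorField I M) x := by
    intro Y x hx
    have h1 : ((⁅Z₁, compactVectorFields.funSMul ℓ Y⁆ : compactVectorFields I M) :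
        SmoothVectorField I M) x = ((⁅X, compactVectorFields.funSMul ℓ Y⁆ :
          compactVectorFields I M) : SmoothVectorField I M) x := by
      refine SmoothVectorField.lie_apply_congr ?_ (Filter.Eventually.of_forall fun _ => rfl)
      filter_upwards [hV.mem_nhds hx] with z hz using hZ₁ z hz
    have h2 : ((⁅Z₂, Y⁆ : compactVectorFields I M) : SmoothVectorField I M) x =
        ((⁅compactVectorFields.funSMul ℓ X, Y⁆ :
          compactVectorFields I M) : SmoothVectorField I M) x := by
      refine SmoothVectorField.lie_apply_congr ?_ (Filter.Eventually.of_forall fun _ => rfl)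
      filter_upwards [hV.mem_nhds hx] with z hz using hZ₂ z hz
    change ((⁅Z₁, compactVectorFields.funSMul ℓ Y⁆ : compactVectorFields I M) :
        SmoothVectorField I M) x -
      ((⁅Z₂, Y⁆ : compactVectorFields I M) : SmoothVectorField I M) x = _
    rw [h1, h2, compactVectorFields.lie_funSMul_apply, compactVectorFields.funSMul_lie_apply,
      hX x hx]
    module
  have hQ_supp : ∀ Y : compactVectorFields I M, (Q Y : SmoothVectorField I M).supp ⊆
      (Y : SmoothVectorField I M).supp := by
    intro Y
    refine closure_minimal (fun x hx => ?_) (SmoothVectorField.isClosed_supp _)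
    by_contra hxY
    refine hx ?_
    change ((⁅Z₁, compactVectorFields.funSMul ℓ Y⁆ : compactVectorFields I M) :
        SmoothVectorField I M) x -
      ((⁅Z₂, Y⁆ : compactVectorFields I M) : SmoothVectorField I M) x = 0
    rw [SmoothVectorField.eq_zero_of_notMem_supp, SmoothVectorField.eq_zero_of_notMem_supp,
      sub_zero]
    · exact fun h => hxY (SmoothVectorField.supp_lie_subset_right _ _ h)
    · exact fun h => hxY (compactVectorFields.supp_funSMul_subset _ _
        (SmoothVectorField.supp_lie_subset_right _ _ h))
  have hQQ : (2 : ℝ) • Y = (3 : ℝ) • Q Y - Q (Q Y) := by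
    ext x
    change (2 : ℝ) • (Y : SmoothVectorField I M) x =
      (3 : ℝ) • (Q Y : SmoothVectorField I M) x - (Q (Q Y) : SmoothVectorField I M) x
    by_cases hx : x ∈ V
    · rw [hQ_in (Q Y) x hx, hQ_in Y x hx, map_add, map_smul, hX x hx, smul_eq_mul, mul_one]
      module
    · have h0 : x ∉ (Y : SmoothVectorField I M).supp := fun h => hx (hY h)
      have h1 := fun h => h0 (hQ_supp Y h)
      have h2 := fun h => h1 (hQ_supp (Q Y) h)
      rw [SmoothVectorField.eq_zero_of_notMem_supp h0, SmoothVectorField.eq_zero_of_notMem_supp h1,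
        SmoothVectorField.eq_zero_of_notMem_supp h2]
      simp
  have hYO := hY.trans hVO
  have h2 : (2 : ℝ) • T Y = 0 := by
    rw [← map_smul, hQQ, map_sub, map_smul, hTQ Y hYO, hTQ _ ((hQ_supp Y).trans hYO), smul_zero,
      sub_zero]
  exact (smul_eq_zero.1 h2).resolve_left two_ne_zero

/-- The Lie algebra of compactly supported vector fields with support in an open set has no proper
ideal of finite codimension. The ideal is given as the kernel of a linear map. -/
theorem map_eq_zero_of_supp_subset [T2Space M] [SecondCountableTopology M]
    {W : Type*} [AddCommGroup W] [Module ℝ W]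
    [FiniteDimensional ℝ W] (T : compactVectorFields I M →ₗ[ℝ] W) {O : Set M} (hO : IsOpen O)
    (hT : ∀ v w : compactVectorFields I M, (v : SmoothVectorField I M).supp ⊆ O →
      (w : SmoothVectorField I M).supp ⊆ O → T w = 0 → T ⁅v, w⁆ = 0)
    {v : compactVectorFields I M} (hv : (v : SmoothVectorField I M).supp ⊆ O) : T v = 0 := by
  rcases subsingleton_or_nontrivial E with hE | hE
  · have : v = 0 := by
      ext x
      exact Subsingleton.elim (α := E) _ _
    rw [this, map_zero]
  have : LocallyCompactSpace M := Manifold.locallyCompact_of_finiteDimensional I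
  choose! X ℓ V hVo hyV hXO hX using
    fun (y : M) (hy : y ∈ O) => exists_vectorField_mvfderiv_eq_one (I := I) hO hy
  obtain ⟨t, hcov⟩ := IsCompact.elim_nhds_subcover' v.2 (fun y _ => V y)
    (fun y hy => (hVo y (hv hy)).mem_nhds (hyV y (hv hy)))
  obtain ⟨ρ, hρ⟩ := SmoothPartitionOfUnity.exists_isSubordinate I
    (SmoothVectorField.isClosed_supp (v : SmoothVectorField I M)) (fun i : t => V i.1)
    (fun i => hVo _ (hv i.1.2)) (by simpa [iUnion_subtype] using hcov)
  have hsum : v = ∑ i : t, compactVectorFields.funSMul (ρ i) v := by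
    ext x
    have h1 : ((∑ i : t, compactVectorFields.funSMul (ρ i) v : compactVectorFields I M) :
        SmoothVectorField I M) x = ∑ i : t, ρ i x • (v : SmoothVectorField I M) x := by
      let ev : compactVectorFields I M →+ TangentSpace I x :=
        { toFun := fun w => (w : SmoothVectorField I M) x
          map_zero' := rfl
          map_add' := fun _ _ => rfl }
      exact map_sum ev _ _
    rw [h1, ← Finset.sum_smul]
    by_cases hx : x ∈ (v : SmoothVectorField I M).supp
    · rw [← finsum_eq_sum_of_fintype, ρ.sum_eq_one hx, one_smul]
    · rw [SmoothVectorField.eq_zero_of_notMem_supp hx, smul_zero]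
  rw [hsum, map_sum]
  refine Finset.sum_eq_zero fun i _ => ?_
  refine map_eq_zero_of_supp_subset_of_mvfderiv_eq_one T hT (hVo _ (hv i.1.2)) (hXO _ (hv i.1.2))
    (hX _ (hv i.1.2)) ?_
  have hsupp : {x | (compactVectorFields.funSMul (ρ i) v : SmoothVectorField I M) x ≠ 0} ⊆
      Function.support (ρ i) := fun x hx h0 => hx <| by
    have h0' : ρ i x = 0 := h0
    rw [compactVectorFields.funSMul_apply, h0', zero_smul]
  exact (closure_mono hsupp).trans (hρ i)

end BaseManifold

section TangentBracket

set_option linter.unusedSectionVars false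

variable {E : Type*} [NormedAddCommGroup E] [NormedSpace ℝ E] [FiniteDimensional ℝ E]
  {H : Type*} [TopologicalSpace H] {I : ModelWithCorners ℝ E H}
  {M : Type*} [TopologicalSpace M] [ChartedSpace H M] [IsManifold I ∞ M]

/-- If `V` vanishes on `Z` and `W p` is tangent to `Z` at `p`, then `[W, V]` vanishes at `p`. -/
theorem SmoothVectorField.lie_eq_zero_of_tangent {V W : SmoothVectorField I M} {Z : Set M} {p : M}
    (hp : p ∈ Z) (hV : ∀ q ∈ Z, V q = 0)
    (hW : ∀ f : M → ℝ, MDifferentiableAt I 𝓘(ℝ) f p → (∀ q ∈ Z, f q = 0) →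
      mvfderiv I f p (W p) = 0) :
    (⁅W, V⁆ : SmoothVectorField I M) p = 0 := by
  have : CompleteSpace E := FiniteDimensional.complete ℝ E
  let t := trivializationAt E (TangentSpace I : M → Type _) p
  have hpt : p ∈ t.baseSet := FiberBundle.mem_baseSet_trivializationAt' p
  let b := Module.finBasis ℝ E
  let f : Fin (Module.finrank ℝ E) → M → ℝ := fun i => LinearMap.piApply (t.localFrameCoeff I b i) V
  have hf : ∀ i, MDifferentiableAt I 𝓘(ℝ) (f i) p := fun i =>
    (contMDiffAt_localFrameCoeff (k := ∞) b hpt (V.contMDiff p) i).mdifferentiableAt (by simp)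
  have hF : ∀ i, MDifferentiableAt I I.tangent
      (fun x => (⟨x, t.localFrame b i x⟩ : TangentBundle I M)) p := fun i =>
    (contMDiffAt_localFrame_of_mem (I := I) ∞ t b i hpt).mdifferentiableAt (by simp)
  have hfZ : ∀ i, ∀ q ∈ Z, f i q = 0 := fun i q hq => by
    change t.localFrameCoeff I b i q (V q) = 0
    rw [hV q hq, map_zero]
  have hfF : ∀ i, mlieBracket I W (f i • t.localFrame b i) p = 0 := fun i => by
    rw [mlieBracket_smul_right (hf i) (hF i), hW (f i) (hf i) (hfZ i), hfZ i p hp, zero_smul,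
      zero_smul, add_zero]
  have hfFc : ∀ i, ContMDiffAt I I.tangent ∞
      (fun x => (⟨x, (f i • t.localFrame b i) x⟩ : TangentBundle I M)) p := fun i =>
    (contMDiffAt_localFrameCoeff (k := ∞) b hpt (V.contMDiff p) i).smul_section
      (contMDiffAt_localFrame_of_mem (I := I) ∞ t b i hpt)
  have hsum : ∀ s : Finset (Fin (Module.finrank ℝ E)),
      ContMDiffAt I I.tangent ∞
        (fun x => (⟨x, (∑ i ∈ s, f i • t.localFrame b i) x⟩ : TangentBundle I M)) p ∧
      mlieBracket I W (∑ i ∈ s, f i • t.localFrame b i) p = 0 := by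
    intro s
    induction s using Finset.induction_on with
    | empty =>
      simp only [Finset.sum_empty]
      refine ⟨(0 : SmoothVectorField I M).contMDiff p, ?_⟩
      rw [mlieBracket_zero_right]; rfl
    | insert i s his ih =>
      simp only [Finset.sum_insert his]
      refine ⟨(hfFc i).add_section ih.1, ?_⟩
      rw [mlieBracket_add_right ((hfFc i).mdifferentiableAt (by simp))
        (ih.1.mdifferentiableAt (by simp)), hfF i, ih.2, add_zero]
  have hV' : (V : Π x : M, TangentSpace I x) =ᶠ[𝓝 p] ∑ i, f i • t.localFrame b i := by
    filter_upwards [t.eventually_eq_localFrame_sum_coeff_smul (I := I) b (s := V) hpt] with x hx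
    exact hx.trans (Finset.sum_apply x Finset.univ fun i => f i • t.localFrame b i).symm
  have hW' : (W : Π x : M, TangentSpace I x) =ᶠ[𝓝 p] W := Filter.EventuallyEq.rfl
  exact (hW'.mlieBracket_vectorField_eq hV').trans (hsum _).2

end TangentBracket

section Principal

set_option linter.unusedSectionVars false

variable {EM : Type*} [NormedAddCommGroup EM] [NormedSpace ℝ EM] [FiniteDimensional ℝ EM]
  {HM : Type*} [TopologicalSpace HM] {IM : ModelWithCorners ℝ EM HM}
  {EG : Type*} [NormedAddCommGroup EG] [NormedSpace ℝ EG] [FiniteDimensional ℝ EG]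
  {HG : Type*} [TopologicalSpace HG] {IG : ModelWithCorners ℝ EG HG}
  {EP : Type*} [NormedAddCommGroup EP] [NormedSpace ℝ EP] [FiniteDimensional ℝ EP]
  {HP : Type*} [TopologicalSpace HP] {IP : ModelWithCorners ℝ EP HP}
  {M : Type*} [TopologicalSpace M] [ChartedSpace HM M] [IsManifold IM ∞ M]
  {G : Type*} [TopologicalSpace G] [ChartedSpace HG G] [Group G] [LieGroup IG ∞ G]
  {P : Type*} [TopologicalSpace P] [ChartedSpace HP P] [IsManifold IP ∞ P]
  [MulAction Gᵐᵒᵖ P] {proj : P → M}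

namespace IsPrincipalBundle

/-- The structure group acts transitively on the fibres of a principal bundle. -/
theorem exists_smul_eq (hP : IsPrincipalBundle IM IG IP G proj) {p q : P}
    (hpq : proj q = proj p) : ∃ g : G, MulOpposite.op g • p = q := by
  obtain ⟨e, hpe, -, -, he⟩ := hP.exists_trivialization (proj p)
  have hp : p ∈ e.source := e.mem_source.2 hpe
  have hq : q ∈ e.source := e.mem_source.2 (hpq ▸ hpe)
  refine ⟨(e p).2⁻¹ * (e q).2, ?_⟩
  have hgp : MulOpposite.op ((e p).2⁻¹ * (e q).2) • p ∈ e.source :=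
    e.mem_source.2 ((hP.proj_act _ _).symm ▸ hpe)
  refine e.injOn hgp hq (Prod.ext ?_ ?_)
  · exact (e.coe_fst hgp).trans (((hP.proj_act _ _).trans hpq.symm).trans (e.coe_fst hq).symm)
  · exact (he p hp _).trans (mul_inv_cancel_left _ _)

/-- A vertical tangent vector annihilates the functions that vanish on the fibre. -/
theorem mvfderiv_eq_zero_of_vertical (hP : IsPrincipalBundle IM IG IP G proj) {p : P}
    {u : TangentSpace IP p} (hu : mfderiv IP IM proj p u = 0) {f : P → ℝ}
    (hf : MDifferentiableAt IP 𝓘(ℝ) f p) (hfZ : ∀ q ∈ proj ⁻¹' {proj p}, f q = 0) :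
    mvfderiv IP f p u = 0 := by
  obtain ⟨e, hpe, he, hes, -⟩ := hP.exists_trivialization (proj p)
  have hp : p ∈ e.source := e.mem_source.2 hpe
  have hept : e p ∈ e.target := e.map_source hp
  have hsymm : e.toOpenPartialHomeomorph.symm (e p) = p := e.left_inv hp
  have hed : MDifferentiableAt IP (IM.prod IG) e p :=
    (he.contMDiffAt (e.open_source.mem_nhds hp)).mdifferentiableAt (by simp)
  have hesd : MDifferentiableAt (IM.prod IG) IP e.toOpenPartialHomeomorph.symm (e p) :=
    (hes.contMDiffAt (e.open_target.mem_nhds hept)).mdifferentiableAt (by simp)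
  let F : M × G → ℝ := f ∘ e.toOpenPartialHomeomorph.symm
  have hF : MDifferentiableAt (IM.prod IG) 𝓘(ℝ) F (e p) :=
    MDifferentiableAt.comp_of_eq (e p) hf hesd hsymm
  have hfF : f =ᶠ[𝓝 p] F ∘ e := by
    filter_upwards [e.open_source.mem_nhds hp] with q hq
    change f q = f (e.toOpenPartialHomeomorph.symm (e q))
    rw [show e.toOpenPartialHomeomorph.symm (e q) = q from e.left_inv hq]
  have hfst : (mfderiv IP (IM.prod IG) e p u).1 = 0 := by
    have h1 : proj =ᶠ[𝓝 p] Prod.fst ∘ e := by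
      filter_upwards [e.open_source.mem_nhds hp] with q hq using (e.coe_fst hq).symm
    have h2 := mfderiv_comp_apply p (mdifferentiableAt_fst (I := IM) (I' := IG)) hed u
    rw [← h1.mfderiv_eq, mfderiv_fst] at h2
    exact h2.symm.trans hu
  have hfib : (fun h : G => F ((e p).1, h)) = fun _ => (0 : ℝ) := by
    funext h
    refine hfZ _ ?_
    rw [mem_preimage, mem_singleton_iff, e.coe_fst hp]
    exact e.proj_symm_apply' hpe
  have h3 := mfderiv_comp_apply p hF hed u
  rw [← hfF.mfderiv_eq] at h3
  refine h3.trans ?_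
  rw [mfderiv_prod_eq_add_apply hF, hfib, mfderiv_const]
  refine (add_zero _).trans ?_
  exact (congrArg _ hfst).trans (map_zero _)

/-- If `V` and `W` are invariant fields, `W` is vertical at `p` and `V` vanishes at `p`, then
`[W, V]` vanishes at `p`. -/
theorem lie_eq_zero_of_vertical (hP : IsPrincipalBundle IM IG IP G proj)
    {V W : SmoothVectorField IP P} (hV : IsInvariantVectorField G V) {p : P} (hVp : V p = 0)
    (hW : mfderiv IP IM proj p (W p) = 0) :
    (⁅W, V⁆ : SmoothVectorField IP P) p = 0 := by
  refine SmoothVectorField.lie_eq_zero_of_tangent (Z := proj ⁻¹' {proj p}) rfl (fun q hq => ?_)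
    fun f hf hfZ => hP.mvfderiv_eq_zero_of_vertical hW hf hfZ
  obtain ⟨g, rfl⟩ := hP.exists_smul_eq hq
  rw [← hV g p, hVp, map_zero]

end IsPrincipalBundle

end Principal

end

theorem mainTheorem4
    {EM : Type*} [NormedAddCommGroup EM] [NormedSpace ℝ EM] [FiniteDimensional ℝ EM]
    {HM : Type*} [TopologicalSpace HM] (IM : ModelWithCorners ℝ EM HM) [IM.Boundaryless]
    {EG : Type*} [NormedAddCommGroup EG] [NormedSpace ℝ EG] [FiniteDimensional ℝ EG]
    {HG : Type*} [TopologicalSpace HG] (IG : ModelWithCorners ℝ EG HG) [IG.Boundaryless]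
    {EP : Type*} [NormedAddCommGroup EP] [NormedSpace ℝ EP] [FiniteDimensional ℝ EP]
    {HP : Type*} [TopologicalSpace HP] (IP : ModelWithCorners ℝ EP HP) [IP.Boundaryless]
    {M : Type*} [TopologicalSpace M] [ChartedSpace HM M] [IsManifold IM ∞ M]
    [T2Space M] [SecondCountableTopology M]
    {G : Type*} [TopologicalSpace G] [ChartedSpace HG G] [Group G] [LieGroup IG ∞ G]
    {P : Type*} [TopologicalSpace P] [ChartedSpace HP P] [IsManifold IP ∞ P]
    [MulAction Gᵐᵒᵖ P]
    {proj : P → M} (hP : IsPrincipalBundle IM IG IP G proj)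
    (σ : compactVectorFields IM M →ₗ⁅ℝ⁆ invariantVectorFields hP)
    (hσ : IsSplitting hP σ) (v : compactVectorFields IM M) :
    proj '' (σ v : SmoothVectorField IP P).supp ⊆ (v : SmoothVectorField IM M).supp := by
  rw [image_subset_iff]
  refine closure_minimal (fun p hp => ?_)
    ((SmoothVectorField.isClosed_supp _).preimage hP.contMDiff_proj.continuous)
  by_contra hpv
  refine hp ?_
  have : FiniteDimensional ℝ (TangentSpace IP p) := inferInstanceAs (FiniteDimensional ℝ EP)
  let T : compactVectorFields IM M →ₗ[ℝ] TangentSpace IP p :=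
    { toFun := fun w => (σ w : SmoothVectorField IP P) p
      map_add' := fun a b => by rw [map_add]; rfl
      map_smul' := fun c a => by rw [map_smul]; rfl }
  refine map_eq_zero_of_supp_subset T (O := {proj p}ᶜ) isOpen_compl_singleton
    (fun a b ha _ hTb => ?_) (fun x hx hxp => hpv (show proj p ∈ _ from hxp ▸ hx))
  change (σ ⁅a, b⁆ : SmoothVectorField IP P) p = 0
  rw [LieHom.map_lie]
  refine hP.lie_eq_zero_of_vertical (σ b).2.1 hTb ?_
  rw [hσ a p]
  exact SmoothVectorField.eq_zero_of_notMem_supp fun h => ha h rfl
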